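/- Let $N\ge 1$, let $\mathcal A\in\mathbb R^{I_1\times\cdots\times I_N}$ be a real tensor, let $1\le n\le N$, and let $A_{(n)}\in\mathbb R^{I_n\times J_n}$ be its mode-$n$ unfolding, where $J_n=\prod_{k\ne n} I_k$ is the number of columns of $A_{(n)}$. Let $T_n\ge 1$ be an integer, let $\mathbf p_n=(p_{n,1},\dots,p_{n,J_n})$ be a probability distribution on $\{1,\dots,J_n\}$, and let $S_n\in\mathbb R^{J_n\times T_n}$ be a random matrix with $S_n\sim\mathrm{RANDSAMPLE}(T_n,\mathbf p_n)$; that is, there are independent random indices $\xi_1,\dots,\xi_{T_n}$ with $\mathbb P(\xi_j=i)=p_{n,i}$ such that $(S_n)_{ij}=1/\sqrt{T_n\,p_{n,i}}$ if $\xi_j=i$ and $(S_n)_{ij}=0$ otherwise. Put $C_n'=A_{(n)}S_n$. (1) Suppose that $\mathbf p_n$ is nearly optimal with constant $\beta\in(0,1]$ for the product $A_{(n)}A_{(n)}^\top$, that is, $$p_{n,i}\ \ge\ \beta\,\frac{\|A_{(n)}(:,i)\|_2^2}{\sum_{j=1}^{J_n}\|A_{(n)}(:,j)\|_2^2}\qquad(1\le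 i\le J_n)$$ (a condition regarded as satisfied if $A_{(n)}=0$). Then for every $\delta_n\in(0,1)$, with $\eta_n=1+\sqrt{(8/\delta_n)\log(1/\delta_n)}$, $$\|A_{(n)}A_{(n)}^\top-C_n'C_n'^\top\|_F\ \le\ \frac{\eta_n}{\sqrt{\beta T_n}}\,\|A_{(n)}\|_F^2$$ with probability at least $1-\delta_n$. (2) Suppose that $\mathbf p_n$ is uniform, that is, $p_{n,i}=1/J_n$ for all $i$. Then for every $\delta_n\in(0,1)$, $$\|A_{(n)}A_{(n)}^\top-C_n'C_n'^\top\|_F\ \le\ \left(1+\sqrt{\frac{J_n}{T_n}}+\frac{J_n}{\sqrt{T_n}}\sqrt{8\log(1/\delta_n)}\right)\|A_{(n)}\|_F^2$$ with probability at least $1-\delta_n$. -/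

import Mathlib

open MeasureTheory ProbabilityTheory
open scoped Matrix Matrix.Norms.Frobenius

/-- Real tensors of order `M + 1` and size `I 0 × I 1 × ⋯ × I M`. -/
abbrev RealTensor {M : ℕ} (I : Fin (M + 1) → ℕ) : Type :=
  (∀ k : Fin (M + 1), Fin (I k)) → ℝ

/-- The product of all dimensions except the `n`-th one: the number of columns of the mode-`n`
unfolding. -/
abbrev unfoldCols {M : ℕ} (I : Fin (M + 1) → ℕ) (n : Fin (M + 1)) : ℕ :=
  ∏ k : Fin M, I (n.succAbove k)

/-- The mode-`n` unfolding: the entry with indices `(i₀, …, i_M)` is placed in row `i_n`, and in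
the column whose number is the mixed-radix number of the remaining indices, the first one varying
fastest (this is the convention of `finPiFinEquiv`). -/
def modeUnfold {M : ℕ} {I : Fin (M + 1) → ℕ} (A : RealTensor I) (n : Fin (M + 1)) :
    Matrix (Fin (I n)) (Fin (unfoldCols I n)) ℝ :=
  Matrix.of fun i j => A (n.insertNth i (finPiFinEquiv.symm j))

/-- `p` is a probability distribution on `Fin J`. -/
structure IsProbDistribution {J : ℕ} (p : Fin J → ℝ) : Prop where
  nonneg : ∀ i, 0 ≤ p i
  sum_eq_one : ∑ i, p i = 1

/-- The random index `ξ` is distributed as `MULTINOMIAL(p)`: `ξ = i` has probability `p i`. -/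
structure IsMultinomial {Ω : Type*} [MeasurableSpace Ω] {J : ℕ} (ξ : Ω → Fin J)
    (p : Fin J → ℝ) (μ : Measure Ω) : Prop where
  isProbDistribution : IsProbDistribution p
  measurable : Measurable ξ
  prob_eq : ∀ i, μ.real {ω | ξ ω = i} = p i

/-- The random `J × L` matrix `S` is distributed as `RANDSAMPLE(L, p)`: its columns are sampled
independently, and column `j` has the single nonzero entry `1 / √(L p_i)` in the random
row `i = ξ_j`, where `ξ_j ∼ MULTINOMIAL(p)`. -/
def IsRandSample {Ω : Type*} [MeasurableSpace Ω] {J : ℕ} (L : ℕ) (p : Fin J → ℝ)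
    (S : Ω → Matrix (Fin J) (Fin L) ℝ) (μ : Measure Ω) : Prop :=
  0 < L ∧ IsProbDistribution p ∧
    ∃ ξ : Fin L → Ω → Fin J,
      (∀ j, IsMultinomial (ξ j) p μ) ∧ iIndepFun ξ μ ∧
        ∀ ω i j, S ω i j = if ξ j ω = i then 1 / √((L : ℝ) * p i) else 0

/-- The Euclidean norm of column `i` of `A`. -/
noncomputable def colNorm {m J : ℕ} (A : Matrix (Fin m) (Fin J) ℝ) (i : Fin J) : ℝ :=
  ‖WithLp.toLp 2 (fun k => A k i)‖

/-- The Euclidean norm of row `i` of `B`. -/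
noncomputable def rowNorm {J l : ℕ} (B : Matrix (Fin J) (Fin l) ℝ) (i : Fin J) : ℝ :=
  ‖WithLp.toLp 2 (fun k => B i k)‖

/-- `p` is a nearly optimal probability distribution, with constant `β ∈ (0, 1]`, for sampling
the product `A * B`. -/
structure IsNearlyOptimal {m J l : ℕ} (β : ℝ) (A : Matrix (Fin m) (Fin J) ℝ)
    (B : Matrix (Fin J) (Fin l) ℝ) (p : Fin J → ℝ) : Prop where
  pos : 0 < β
  le_one : β ≤ 1
  isProbDistribution : IsProbDistribution p
  le : ∀ i, β * ((colNorm A i * rowNorm B i) / ∑ j, colNorm A j * rowNorm B j) ≤ p i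

/-- `p` is the uniform distribution on `Fin J`. -/
def IsUniformProb {J : ℕ} (p : Fin J → ℝ) : Prop :=
  ∀ i, p i = 1 / (J : ℝ)

/-! The error `A Aᵀ - C Cᵀ` depends only on the `T` sampled indices: each draw contributes a
rescaled rank-one matrix with mean `A Aᵀ / T`. Probabilities thus become finite weighted sums over
index tuples, and everything is computed with `sampleExpect`.

Entrywise variances add up to `E‖error‖² ≤ (∑ ‖a_i‖⁴ / p_i) / T`, where `a_i` is column `i`. Near
optimality bounds this by `‖A‖⁴ / (β T)`. Markov's inequality for the squared norm then gives (1),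
since `δ η² ≥ 1`; no concentration inequality is needed.

Uniform sampling bounds the same quantity by `(J / T) ‖A‖⁴`, so the mean error is at most `√(J / T)
‖A‖²`. Changing one index moves the error norm by at most `2 (J / T) ‖A‖²`, and McDiarmid's
inequality gives the deviation term in (2). -/

/-- The expectation of `f` under `T` independent draws from the weights `p`. -/
noncomputable def sampleExpect {J : ℕ} (p : Fin J → ℝ) (T : ℕ) (f : (Fin T → Fin J) → ℝ) : ℝ :=
  ∑ x, (∏ j, p (x j)) * f x

/-! ### Moments under finite product distributions. -/

section SampleExpect

variable {J : ℕ} {p : Fin J → ℝ} {T : ℕ}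

lemma sampleExpect_zero (f : (Fin 0 → Fin J) → ℝ) :
    sampleExpect p 0 f = f Fin.elim0 := by
  simp [sampleExpect, Subsingleton.elim _ (Fin.elim0 : Fin 0 → Fin J)]

/-- Averaging out the first index alone is what drives the inductions on the number of draws. -/
lemma sampleExpect_succ (f : (Fin (T + 1) → Fin J) → ℝ) :
    sampleExpect p (T + 1) f =
      sampleExpect p T fun x => ∑ i, p i * f (Fin.cons i x) := by
  unfold sampleExpect
  rw [← (Fin.consEquiv fun _ : Fin (T + 1) => Fin J).sum_comp, Fintype.sum_prod_type,
    Finset.sum_comm]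
  refine Finset.sum_congr rfl fun x _ => ?_
  rw [Finset.mul_sum]
  refine Finset.sum_congr rfl fun i _ => ?_
  change (∏ j, p ((Fin.cons i x : Fin (T + 1) → Fin J) j)) * f (Fin.cons i x) = _
  simp only [Fin.prod_univ_succ, Fin.cons_zero, Fin.cons_succ]
  ring

lemma sampleExpect_add (f g : (Fin T → Fin J) → ℝ) :
    sampleExpect p T (fun x => f x + g x) = sampleExpect p T f + sampleExpect p T g := by
  simp [sampleExpect, mul_add, Finset.sum_add_distrib]

lemma sampleExpect_mul_left (c : ℝ) (f : (Fin T → Fin J) → ℝ) :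
    sampleExpect p T (fun x => c * f x) = c * sampleExpect p T f := by
  simp only [sampleExpect, Finset.mul_sum]
  exact Finset.sum_congr rfl fun x _ => by ring

lemma sampleExpect_sum {ι : Type*} (s : Finset ι) (f : ι → (Fin T → Fin J) → ℝ) :
    sampleExpect p T (fun x => ∑ a ∈ s, f a x) = ∑ a ∈ s, sampleExpect p T (f a) := by
  simp only [sampleExpect, Finset.mul_sum]
  exact Finset.sum_comm

lemma sampleExpect_const (hp : IsProbDistribution p) (c : ℝ) :
    sampleExpect p T (fun _ => c) = c := by
  induction T with
  | zero => exact sampleExpect_zero _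
  | succ T ih => rw [sampleExpect_succ, ← Finset.sum_mul, hp.sum_eq_one, one_mul, ih]

lemma sampleExpect_mono (hp : IsProbDistribution p) {f g : (Fin T → Fin J) → ℝ}
    (h : ∀ x, f x ≤ g x) : sampleExpect p T f ≤ sampleExpect p T g :=
  Finset.sum_le_sum fun x _ =>
    mul_le_mul_of_nonneg_left (h x) (Finset.prod_nonneg fun _ _ => hp.nonneg _)

/-- The variance of a sum of independent centred variables. -/
lemma sampleExpect_sum_sq {u : Fin J → ℝ} (hp : IsProbDistribution p)
    (hu : ∑ i, p i * u i = 0) :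
    sampleExpect p T (fun x => (∑ j, u (x j)) ^ 2) = T * ∑ i, p i * u i ^ 2 := by
  induction T with
  | zero => simp [sampleExpect_zero]
  | succ T ih =>
    rw [sampleExpect_succ]
    have h : ∀ x : Fin T → Fin J,
        ∑ i, p i * (∑ j, u ((Fin.cons i x : Fin (T + 1) → Fin J) j)) ^ 2 =
          (∑ i, p i * u i ^ 2) + (∑ j, u (x j)) ^ 2 := by
      intro x
      simp only [Fin.sum_univ_succ, Fin.cons_zero, Fin.cons_succ]
      generalize ∑ j, u (x j) = s
      calc ∑ i, p i * (u i + s) ^ 2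
          = (∑ i, p i * u i ^ 2) + 2 * s * (∑ i, p i * u i) + s ^ 2 * ∑ i, p i := by
            simp only [Finset.mul_sum, ← Finset.sum_add_distrib]
            exact Finset.sum_congr rfl fun i _ => by ring
        _ = _ := by rw [hu, hp.sum_eq_one]; ring
    simp only [h]
    rw [sampleExpect_add, sampleExpect_const hp, ih]
    push_cast
    ring

lemma sampleExpect_sub_sum_sq_le {v : Fin J → ℝ} {m : ℝ} (hp : IsProbDistribution p)
    (hv : ∑ i, p i * v i = m) :
    sampleExpect p T (fun x => (T * m - ∑ j, v (x j)) ^ 2) ≤ T * ∑ i, p i * v i ^ 2 := by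
  have hu : ∑ i, p i * (m - v i) = 0 := by
    simp [mul_sub, Finset.sum_sub_distrib, ← Finset.sum_mul, hp.sum_eq_one, hv]
  have h := sampleExpect_sum_sq (T := T) hp hu
  simp only [Finset.sum_sub_distrib, Finset.sum_const, Finset.card_univ, Fintype.card_fin,
    nsmul_eq_mul] at h
  rw [h]
  refine mul_le_mul_of_nonneg_left ?_ T.cast_nonneg
  have : ∑ i, p i * (m - v i) ^ 2 = (∑ i, p i * v i ^ 2) - m ^ 2 := by
    calc ∑ i, p i * (m - v i) ^ 2
        = (∑ i, p i * v i ^ 2) - 2 * m * (∑ i, p i * v i) + m ^ 2 * ∑ i, p i := by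
          simp only [Finset.mul_sum, ← Finset.sum_add_distrib, ← Finset.sum_sub_distrib]
          exact Finset.sum_congr rfl fun i _ => by ring
      _ = _ := by rw [hv, hp.sum_eq_one]; ring
  rw [this]
  linarith [sq_nonneg m]

/-- The variance `E (f - E f)²` is nonnegative. -/
lemma sampleExpect_sq_le (hp : IsProbDistribution p) (f : (Fin T → Fin J) → ℝ) :
    sampleExpect p T f ^ 2 ≤ sampleExpect p T (fun x => f x ^ 2) := by
  have h : 0 ≤ sampleExpect p T (fun x => f x ^ 2 +
      (-(2 * sampleExpect p T f) * f x + sampleExpect p T f ^ 2)) := by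
    calc (0 : ℝ) = sampleExpect p T (fun _ => 0) := (sampleExpect_const hp 0).symm
      _ ≤ _ := sampleExpect_mono hp fun x => by nlinarith [sq_nonneg (f x - sampleExpect p T f)]
  rw [sampleExpect_add, sampleExpect_add, sampleExpect_mul_left, sampleExpect_const hp] at h
  linarith

-- Markov's inequality, normalised to threshold `1`; it serves for both squared and exponential test
-- functions.
open Classical in
lemma sampleExpect_indicator_le (hp : IsProbDistribution p) {P : (Fin T → Fin J) → Prop}
    {f : (Fin T → Fin J) → ℝ} (h0 : ∀ x, 0 ≤ f x) (h1 : ∀ x, P x → 1 ≤ f x) :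
    sampleExpect p T (fun x => if P x then 1 else 0) ≤ sampleExpect p T f :=
  sampleExpect_mono hp fun x => by
    split_ifs with h
    exacts [h1 x h, h0 x]

/-! ### Exponential moments and McDiarmid's inequality. -/

/-- A weak form of Hoeffding's lemma for a finite distribution. -/
lemma sum_mul_exp_le {y : Fin J → ℝ} (hp : IsProbDistribution p) (hy : ∑ i, p i * y i = 0)
    {a : ℝ} (ha : 0 < a) (hya : ∀ i, |y i| ≤ a) :
    ∑ i, p i * Real.exp (y i) ≤ Real.exp (a ^ 2 / 2) := by
  refine le_trans ?_ (Real.cosh_le_exp_half_sq a)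
  have h : ∀ i, Real.exp (y i) ≤ Real.cosh a + y i * (Real.sinh a / a) := by
    intro i
    have hi := abs_le.mp (hya i)
    -- On `[-a, a]` the exponential lies below its chord `cosh a + y (sinh a / a)`, whose linear
    -- term has mean zero.
    have hc := convexOn_exp.2 (Set.mem_univ a) (Set.mem_univ (-a))
      (show 0 ≤ (a + y i) / (2 * a) from div_nonneg (by linarith) (by linarith))
      (show 0 ≤ (a - y i) / (2 * a) from div_nonneg (by linarith) (by linarith))
      (by field_simp; ring)
    have e : ((a + y i) / (2 * a)) • a + ((a - y i) / (2 * a)) • (-a) = y i := by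
      simp only [smul_eq_mul]; field_simp; ring
    rw [e] at hc
    refine hc.trans (le_of_eq ?_)
    rw [Real.cosh_eq, Real.sinh_eq, smul_eq_mul, smul_eq_mul]
    field_simp
    ring
  calc ∑ i, p i * Real.exp (y i)
      ≤ ∑ i, p i * (Real.cosh a + y i * (Real.sinh a / a)) :=
        Finset.sum_le_sum fun i _ => mul_le_mul_of_nonneg_left (h i) (hp.nonneg i)
    _ = Real.cosh a * (∑ i, p i) + (Real.sinh a / a) * ∑ i, p i * y i := by
        simp only [Finset.mul_sum, ← Finset.sum_add_distrib]
        exact Finset.sum_congr rfl fun i _ => by ring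
    _ = Real.cosh a := by rw [hy, hp.sum_eq_one]; ring

/-- The mean is an average of values within `c` of `h i`. Using only the interval `[-c, c]` loses a
factor 4 in the McDiarmid exponent, which the constant 8 in the theorem absorbs. -/
lemma abs_sub_sum_mul_le {h : Fin J → ℝ} (hp : IsProbDistribution p) {c : ℝ}
    (hc : ∀ i k, |h i - h k| ≤ c) (i : Fin J) : |h i - ∑ k, p k * h k| ≤ c := by
  have e : h i - ∑ k, p k * h k = ∑ k, p k * (h i - h k) := by
    simp [mul_sub, Finset.sum_sub_distrib, ← Finset.sum_mul, hp.sum_eq_one]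
  rw [e]
  calc |∑ k, p k * (h i - h k)| ≤ ∑ k, |p k * (h i - h k)| := Finset.abs_sum_le_sum_abs _ _
    _ ≤ ∑ k, p k * c := Finset.sum_le_sum fun k _ => by
        rw [abs_mul, abs_of_nonneg (hp.nonneg k)]
        exact mul_le_mul_of_nonneg_left (hc i k) (hp.nonneg k)
    _ = c := by rw [← Finset.sum_mul, hp.sum_eq_one, one_mul]

/-- The exponential moment bound behind McDiarmid's inequality. -/
lemma sampleExpect_exp_le (hp : IsProbDistribution p) {c s : ℝ} (hc : 0 < c) (hs : 0 < s)
    (f : (Fin T → Fin J) → ℝ)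
    (hf : ∀ x j i, |f x - f (Function.update x j i)| ≤ c) :
    sampleExpect p T (fun x => Real.exp (s * (f x - sampleExpect p T f))) ≤
      Real.exp (T * ((s * c) ^ 2 / 2)) := by
  induction T with
  | zero => simp [sampleExpect_zero]
  | succ T ih =>
    -- Martingale splitting: `f - E f = (f - g) + (g - E g)`, where `g` averages out the first index
    -- and inherits bounded differences.
    set g : (Fin T → Fin J) → ℝ := fun x => ∑ i, p i * f (Fin.cons i x) with hg
    have hfg : sampleExpect p (T + 1) f = sampleExpect p T g := sampleExpect_succ f
    have hgb : ∀ x j i, |g x - g (Function.update x j i)| ≤ c := by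
      intro x j i
      have e : g x - g (Function.update x j i) =
          ∑ k, p k * (f (Fin.cons k x) - f (Fin.cons k (Function.update x j i))) := by
        simp [hg, mul_sub, Finset.sum_sub_distrib]
      rw [e]
      calc _ ≤ ∑ k, |p k * (f (Fin.cons k x) - f (Fin.cons k (Function.update x j i)))| :=
            Finset.abs_sum_le_sum_abs _ _
        _ ≤ ∑ k, p k * c := Finset.sum_le_sum fun k _ => by
            rw [abs_mul, abs_of_nonneg (hp.nonneg k), Fin.cons_update]
            exact mul_le_mul_of_nonneg_left (hf _ _ _) (hp.nonneg k)
        _ = c := by rw [← Finset.sum_mul, hp.sum_eq_one, one_mul]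
    rw [sampleExpect_succ, hfg]
    have step : ∀ x : Fin T → Fin J,
        ∑ i, p i * Real.exp (s * (f (Fin.cons i x) - sampleExpect p T g)) ≤
          Real.exp ((s * c) ^ 2 / 2) * Real.exp (s * (g x - sampleExpect p T g)) := by
      intro x
      have hb : ∀ i, |f (Fin.cons i x) - g x| ≤ c :=
        abs_sub_sum_mul_le (h := fun i => f (Fin.cons i x)) hp fun i k => by
          have := hf (Fin.cons i x) 0 k
          rwa [Fin.update_cons_zero] at this
      have hz : ∑ i, p i * (s * (f (Fin.cons i x) - g x)) = 0 := by
        have : ∑ i, p i * (s * (f (Fin.cons i x) - g x)) =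
            s * ((∑ i, p i * f (Fin.cons i x)) - g x * ∑ i, p i) := by
          rw [Finset.mul_sum, ← Finset.sum_sub_distrib, Finset.mul_sum]
          exact Finset.sum_congr rfl fun i _ => by ring
        rw [this, hp.sum_eq_one, hg]
        ring
      have := sum_mul_exp_le hp hz (mul_pos hs hc) fun i => by
        rw [abs_mul, abs_of_pos hs]
        exact mul_le_mul_of_nonneg_left (hb i) hs.le
      refine le_trans (le_of_eq ?_) (mul_le_mul_of_nonneg_right this (Real.exp_pos _).le)
      rw [Finset.sum_mul]
      refine Finset.sum_congr rfl fun i _ => ?_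
      rw [mul_assoc, ← Real.exp_add]
      congr 2
      ring
    refine (sampleExpect_mono hp step).trans ?_
    rw [sampleExpect_mul_left]
    refine (mul_le_mul_of_nonneg_left (ih g hgb) (Real.exp_pos _).le).trans (le_of_eq ?_)
    rw [← Real.exp_add]
    congr 1
    push_cast
    ring

open Classical in
/-- McDiarmid's inequality for a finite distribution, with the constant of Azuma's inequality. -/
lemma sampleExpect_indicator_le_exp (hp : IsProbDistribution p) {c t : ℝ} (hc : 0 < c)
    (ht : 0 < t) (hT : 0 < T) (f : (Fin T → Fin J) → ℝ)
    (hf : ∀ x j i, |f x - f (Function.update x j i)| ≤ c) :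
    sampleExpect p T (fun x => if sampleExpect p T f + t < f x then 1 else 0) ≤
      Real.exp (-(t ^ 2 / (2 * T * c ^ 2))) := by
  have hT' : (0 : ℝ) < T := Nat.cast_pos.mpr hT
  -- This `s` minimises the exponent `-s t + T (s c)² / 2`.
  set s := t / (T * c ^ 2) with hs
  have hs0 : 0 < s := by positivity
  have h1 := sampleExpect_indicator_le (P := fun x => sampleExpect p T f + t < f x)
    (f := fun x => Real.exp (-(s * t)) * Real.exp (s * (f x - sampleExpect p T f))) hp
    (fun x => by positivity) (fun x hx => by
      rw [← Real.exp_add, ← Real.exp_zero]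
      apply Real.exp_le_exp.mpr
      nlinarith)
  refine h1.trans ?_
  rw [sampleExpect_mul_left]
  refine (mul_le_mul_of_nonneg_left (sampleExpect_exp_le hp hc hs0 f hf)
    (Real.exp_pos _).le).trans (le_of_eq ?_)
  rw [← Real.exp_add]
  congr 1
  rw [hs]
  field_simp
  ring

/-! ### Transfer to the underlying probability space. -/

open Classical in
lemma measureReal_eq_sampleExpect {Ω : Type*} [MeasurableSpace Ω] {μ : Measure Ω}
    [IsProbabilityMeasure μ] {ξ : Fin T → Ω → Fin J} (hξ : ∀ j, IsMultinomial (ξ j) p μ)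
    (hind : iIndepFun ξ μ) (P : (Fin T → Fin J) → Prop) :
    μ.real {ω | P fun j => ξ j ω} = sampleExpect p T (fun x => if P x then 1 else 0) := by
  have hm : Measurable fun ω j => ξ j ω := measurable_pi_lambda _ fun j => (hξ j).measurable
  -- Independence gives each index tuple its product weight; an event in the indices is a finite
  -- disjoint union of such atoms.
  have hx : ∀ x : Fin T → Fin J, μ.real {ω | (fun j => ξ j ω) = x} = ∏ j, p (x j) := by
    intro x
    have e : {ω | (fun j => ξ j ω) = x} = ⋂ j ∈ Finset.univ, ξ j ⁻¹' {x j} := by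
      ext ω; simp [funext_iff]
    rw [measureReal_def, e, hind.measure_inter_preimage_eq_mul Finset.univ
      (fun j _ => measurableSet_singleton _), ENNReal.toReal_prod]
    exact Finset.prod_congr rfl fun j _ => (hξ j).prob_eq (x j)
  have e : {ω | P fun j => ξ j ω} =
      ⋃ x ∈ Finset.univ.filter P, {ω | (fun j => ξ j ω) = x} := by
    ext ω; simp
  rw [e, measureReal_biUnion_finset]
  · simp [sampleExpect, hx, Finset.sum_filter]
  · intro x _ y _ hxy
    exact Set.disjoint_left.mpr fun ω h1 h2 => hxy (h1.symm.trans h2)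
  · exact fun x _ => hm (measurableSet_singleton x)

open Classical in
lemma one_sub_le_measureReal {Ω : Type*} [MeasurableSpace Ω] {μ : Measure Ω}
    [IsProbabilityMeasure μ] {ξ : Fin T → Ω → Fin J} (hp : IsProbDistribution p)
    (hξ : ∀ j, IsMultinomial (ξ j) p μ) (hind : iIndepFun ξ μ) {f : (Fin T → Fin J) → ℝ}
    {b δ : ℝ} (h : sampleExpect p T (fun x => if b < f x then 1 else 0) ≤ δ) :
    1 - δ ≤ μ.real {ω | f (fun j => ξ j ω) ≤ b} := by
  rw [measureReal_eq_sampleExpect hξ hind fun x => f x ≤ b]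
  have : sampleExpect p T (fun x => if f x ≤ b then 1 else 0) +
      sampleExpect p T (fun x => if b < f x then 1 else 0) = 1 := by
    rw [← sampleExpect_add]
    refine Eq.trans ?_ (sampleExpect_const (T := T) hp 1)
    congr 1
    funext x
    by_cases hx : f x ≤ b
    · simp [hx, not_lt.mpr hx]
    · simp [hx, not_le.mp hx]
  linarith

end SampleExpect

/-! ### The error of the sampled product. -/

section RandomProduct

lemma frobenius_norm_sq {m n : ℕ} (A : Matrix (Fin m) (Fin n) ℝ) :
    ‖A‖ ^ 2 = ∑ i, ∑ j, A i j ^ 2 := by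
  have h : 0 ≤ ∑ i, ∑ j, A i j ^ 2 :=
    Finset.sum_nonneg fun i _ => Finset.sum_nonneg fun j _ => sq_nonneg _
  rw [Matrix.frobenius_norm_def]
  simp only [Real.rpow_two, Real.norm_eq_abs, sq_abs]
  rw [← Real.sqrt_eq_rpow, Real.sq_sqrt h]

variable {m J : ℕ} (A : Matrix (Fin m) (Fin J) ℝ)

lemma colNorm_sq (i : Fin J) : colNorm A i ^ 2 = ∑ k, A k i ^ 2 := by
  simp [colNorm, EuclideanSpace.norm_sq_eq]

lemma rowNorm_transpose (i : Fin J) : rowNorm Aᵀ i = colNorm A i := rfl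

lemma sum_colNorm_sq : ∑ i, colNorm A i ^ 2 = ‖A‖ ^ 2 := by
  simp only [colNorm_sq, frobenius_norm_sq]
  exact Finset.sum_comm

lemma colNorm_sq_le (i : Fin J) : colNorm A i ^ 2 ≤ ‖A‖ ^ 2 := by
  rw [← sum_colNorm_sq]
  exact Finset.single_le_sum (f := fun i => colNorm A i ^ 2) (fun _ _ => sq_nonneg _)
    (Finset.mem_univ i)

/-- The rank one matrix `A(:,i) A(:,i)ᵀ`. -/
def colOuter (i : Fin J) : Matrix (Fin m) (Fin m) ℝ := Matrix.of fun a b => A a i * A b i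

lemma norm_colOuter (i : Fin J) : ‖colOuter A i‖ = colNorm A i ^ 2 := by
  rw [← sq_eq_sq₀ (norm_nonneg _) (sq_nonneg _), frobenius_norm_sq, colNorm_sq, sq (∑ k, _),
    Finset.sum_mul_sum]
  simp [colOuter, mul_pow]

/-- The difference between `A Aᵀ` and its estimate from the sampled columns `x`. -/
noncomputable def sampleError (T : ℕ) (p : Fin J → ℝ) (x : Fin T → Fin J) :
    Matrix (Fin m) (Fin m) ℝ :=
  A * Aᵀ - ∑ j, ((T : ℝ) * p (x j))⁻¹ • colOuter A (x j)

variable {A} {T : ℕ} {p : Fin J → ℝ}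

/-- A column of `S` has one possibly nonzero entry, so column `j` of `A * S` is a multiple of column
`x j` of `A`. The identity survives `p (x j) = 0`, where both weights are zero by convention. -/
lemma sub_mul_transpose_eq_sampleError (hp : IsProbDistribution p) {x : Fin T → Fin J}
    {S : Matrix (Fin J) (Fin T) ℝ}
    (hS : ∀ i j, S i j = if x j = i then 1 / √((T : ℝ) * p i) else 0) :
    A * Aᵀ - (A * S) * (A * S)ᵀ = sampleError A T p x := by
  have h : ∀ a j, (A * S) a j = A a (x j) * (1 / √((T : ℝ) * p (x j))) := by
    intro a j
    simp [Matrix.mul_apply, hS]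
  unfold sampleError
  congr 1
  ext a b
  rw [Matrix.mul_apply, Matrix.sum_apply]
  refine Finset.sum_congr rfl fun j _ => ?_
  rw [Matrix.transpose_apply, h, h, Matrix.smul_apply, smul_eq_mul, colOuter, Matrix.of_apply]
  have : (1 / √((T : ℝ) * p (x j))) * (1 / √((T : ℝ) * p (x j))) = ((T : ℝ) * p (x j))⁻¹ := by
    rw [div_mul_div_comm, one_mul, Real.mul_self_sqrt
      (mul_nonneg T.cast_nonneg (hp.nonneg _)), one_div]
  rw [← this]
  ring

/-- The second moment of the error of the sampled product. -/
lemma sampleExpect_norm_sampleError_sq_le (hp : IsProbDistribution p) (hT : 0 < T)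
    (hpA : ∀ i, p i = 0 → colNorm A i = 0) :
    sampleExpect p T (fun x => ‖sampleError A T p x‖ ^ 2) ≤
      (∑ i, (p i)⁻¹ * (colNorm A i ^ 2) ^ 2) / T := by
  have hT' : (0 : ℝ) < T := Nat.cast_pos.mpr hT
  have hA : ∀ i, p i = 0 → ∀ a, A a i = 0 := by
    intro i hi a
    have h := colNorm_sq A i
    rw [hpA i hi, zero_pow two_ne_zero, eq_comm,
      Finset.sum_eq_zero_iff_of_nonneg fun _ _ => sq_nonneg _] at h
    exact pow_eq_zero_iff two_ne_zero |>.mp (h a (Finset.mem_univ a))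
  have hab : ∀ a b, sampleExpect p T (fun x => sampleError A T p x a b ^ 2) ≤
      T * ∑ i, p i * (((T : ℝ) * p i)⁻¹ * colOuter A i a b) ^ 2 := by
    intro a b
    -- Unbiasedness of one draw. An index of probability zero is never sampled, so its column has to
    -- vanish.
    have hv : ∑ i, p i * (((T : ℝ) * p i)⁻¹ * colOuter A i a b) = (A * Aᵀ) a b / T := by
      rw [Matrix.mul_apply, Finset.sum_div]
      refine Finset.sum_congr rfl fun i _ => ?_
      rw [Matrix.transpose_apply, colOuter, Matrix.of_apply]
      by_cases hi : p i = 0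
      · simp [hi, hA i hi]
      · field_simp
    have h := sampleExpect_sub_sum_sq_le (T := T) hp hv
    rw [mul_div_cancel₀ _ hT'.ne'] at h
    simpa [sampleError, Matrix.sum_apply] using h
  calc sampleExpect p T (fun x => ‖sampleError A T p x‖ ^ 2)
      = ∑ a, ∑ b, sampleExpect p T (fun x => sampleError A T p x a b ^ 2) := by
        simp only [frobenius_norm_sq, sampleExpect_sum]
    _ ≤ ∑ a, ∑ b, T * ∑ i, p i * (((T : ℝ) * p i)⁻¹ * colOuter A i a b) ^ 2 :=
        Finset.sum_le_sum fun a _ => Finset.sum_le_sum fun b _ => hab a b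
    _ = T * ∑ i, p i * (((T : ℝ) * p i)⁻¹) ^ 2 * ‖colOuter A i‖ ^ 2 := by
        simp only [frobenius_norm_sq, Finset.mul_sum]
        rw [Finset.sum_congr rfl fun a _ => Finset.sum_comm, Finset.sum_comm]
        refine Finset.sum_congr rfl fun i _ => Finset.sum_congr rfl fun a _ =>
          Finset.sum_congr rfl fun b _ => by ring
    _ = _ := by
        rw [Finset.mul_sum, Finset.sum_div]
        refine Finset.sum_congr rfl fun i _ => ?_
        rw [norm_colOuter]
        by_cases hi : p i = 0
        · simp [hi]
        · field_simp

lemma sampleError_eq_zero (hA : A = 0) (x : Fin T → Fin J) : sampleError A T p x = 0 := by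
  subst hA
  have : ∀ i, colOuter (0 : Matrix (Fin m) (Fin J) ℝ) i = 0 := fun i => by
    ext; simp [colOuter]
  simp [sampleError, this]

/-- Changing one index exchanges one rank-one term for another, each of norm at most `K`. -/
lemma abs_norm_sampleError_sub_update_le {K : ℝ}
    (hK : ∀ i, ‖((T : ℝ) * p i)⁻¹ • colOuter A i‖ ≤ K) (x : Fin T → Fin J) (j : Fin T)
    (i : Fin J) :
    |‖sampleError A T p x‖ - ‖sampleError A T p (Function.update x j i)‖| ≤ 2 * K := by
  refine (abs_norm_sub_norm_le _ _).trans ?_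
  have e : sampleError A T p x - sampleError A T p (Function.update x j i) =
      ((T : ℝ) * p i)⁻¹ • colOuter A i - ((T : ℝ) * p (x j))⁻¹ • colOuter A (x j) := by
    unfold sampleError
    rw [sub_sub_sub_cancel_left, ← Finset.sum_sub_distrib, Finset.sum_eq_single j]
    · simp
    · intro k _ hk
      simp [Function.update_of_ne hk]
    · simp
  rw [e]
  refine (norm_sub_le _ _).trans ?_
  linarith [hK i, hK (x j)]

end RandomProduct

/-! ### Tail bounds for the two sampling distributions. -/

/-- With `L = log (1 / δ)`, expanding the square gives at least `δ + 8 L`, and `δ = exp (-L) ≥ 1 -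
L`. -/
lemma one_le_mul_sq_of_log {δ : ℝ} (h0 : 0 < δ) (h1 : δ < 1) :
    1 ≤ δ * (1 + √((8 / δ) * Real.log (1 / δ))) ^ 2 := by
  set L := Real.log (1 / δ) with hL
  have hL0 : 0 < L := Real.log_pos (by rw [lt_div_iff₀ h0]; linarith)
  have hδL : Real.exp (-L) = δ := by
    rw [hL, one_div, Real.log_inv, neg_neg, Real.exp_log h0]
  have hd : 1 - L ≤ δ := by
    rw [← hδL]
    linarith [Real.add_one_le_exp (-L)]
  have hs : 0 ≤ √((8 / δ) * L) := Real.sqrt_nonneg _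
  have hsq : √((8 / δ) * L) ^ 2 = (8 / δ) * L := Real.sq_sqrt (by positivity)
  have : δ * (1 + √((8 / δ) * L)) ^ 2 = δ + 8 * L + 2 * (δ * √((8 / δ) * L)) := by
    rw [add_sq, hsq]
    field_simp
    ring
  rw [this]
  have : 0 ≤ δ * √((8 / δ) * L) := by positivity
  linarith

section SampledProductBounds

variable {m J : ℕ} {A : Matrix (Fin m) (Fin J) ℝ} {T : ℕ} {p : Fin J → ℝ}

open Classical in
lemma sampleExpect_indicator_le_of_isNearlyOptimal {β : ℝ} (h : IsNearlyOptimal β A Aᵀ p)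
    (hT : 0 < T) {δ : ℝ} (h0 : 0 < δ) (h1 : δ < 1) :
    sampleExpect p T (fun x => if (1 + √((8 / δ) * Real.log (1 / δ))) / √(β * (T : ℝ)) * ‖A‖ ^ 2 <
      ‖sampleError A T p x‖ then 1 else 0) ≤ δ := by
  have hp := h.isProbDistribution
  have hβ := h.pos
  -- For `A = 0` the threshold vanishes and Markov's inequality cannot be normalised by it, but the
  -- error is identically zero.
  by_cases hA : A = 0
  · subst hA
    simp [sampleError_eq_zero, sampleExpect_const hp, h0.le]
  have hT' : (0 : ℝ) < T := Nat.cast_pos.mpr hT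
  have hN : 0 < ‖A‖ ^ 2 := by positivity
  have hle : ∀ i, β * (colNorm A i ^ 2 / ‖A‖ ^ 2) ≤ p i := by
    intro i
    have := h.le i
    simp only [rowNorm_transpose, ← sq, sum_colNorm_sq] at this
    exact this
  have hle' : ∀ i, β * colNorm A i ^ 2 ≤ p i * ‖A‖ ^ 2 := fun i => by
    have := hle i
    rwa [← mul_div_assoc, div_le_iff₀ hN] at this
  have hpA : ∀ i, p i = 0 → colNorm A i = 0 := by
    intro i hi
    have := hle' i
    rw [hi, zero_mul] at this
    have h2 : colNorm A i ^ 2 ≤ 0 := by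
      by_contra hc
      exact absurd this (not_le.mpr (mul_pos hβ (not_le.mp hc)))
    exact pow_eq_zero_iff two_ne_zero |>.mp (le_antisymm h2 (sq_nonneg _))
  have hmom : sampleExpect p T (fun x => ‖sampleError A T p x‖ ^ 2) ≤
      (‖A‖ ^ 2) ^ 2 / (β * T) := by
    refine (sampleExpect_norm_sampleError_sq_le hp hT hpA).trans ?_
    rw [← div_div]
    refine div_le_div_of_nonneg_right ?_ hT'.le
    -- Near optimality bounds `‖a_i‖² / p_i` by `‖A‖² / β`; the remaining factors `‖a_i‖²` sum to
    -- `‖A‖²`.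
    calc ∑ i, (p i)⁻¹ * (colNorm A i ^ 2) ^ 2
        ≤ ∑ i, ‖A‖ ^ 2 / β * colNorm A i ^ 2 := by
          refine Finset.sum_le_sum fun i _ => ?_
          by_cases hi : p i = 0
          · simp [hi, hpA i hi]
          · have hpi : 0 < p i := lt_of_le_of_ne (hp.nonneg i) (Ne.symm hi)
            rw [sq (colNorm A i ^ 2), ← mul_assoc]
            refine mul_le_mul_of_nonneg_right ?_ (sq_nonneg _)
            rw [inv_mul_eq_div, div_le_div_iff₀ hpi hβ]
            linarith [hle' i]
      _ = (‖A‖ ^ 2) ^ 2 / β := by rw [← Finset.mul_sum, sum_colNorm_sq]; ring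
  set η := 1 + √((8 / δ) * Real.log (1 / δ)) with hη
  have hη0 : 0 < η := by positivity
  have hηδ : 1 ≤ δ * η ^ 2 := one_le_mul_sq_of_log h0 h1
  set b := η / √(β * (T : ℝ)) * ‖A‖ ^ 2 with hb
  have hb0 : 0 < b := by positivity
  have hbsq : b ^ 2 = η ^ 2 * ((‖A‖ ^ 2) ^ 2 / (β * T)) := by
    rw [hb, mul_pow, div_pow, Real.sq_sqrt (by positivity)]
    ring
  have hmark := sampleExpect_indicator_le (P := fun x => b < ‖sampleError A T p x‖)
    (f := fun x => (b ^ 2)⁻¹ * ‖sampleError A T p x‖ ^ 2) hp (fun x => by positivity)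
    (fun x hx => by
      rw [inv_mul_eq_div, one_le_div (by positivity)]
      exact pow_le_pow_left₀ hb0.le hx.le 2)
  refine hmark.trans ?_
  rw [sampleExpect_mul_left, inv_mul_eq_div, div_le_iff₀ (by positivity)]
  refine hmom.trans ?_
  rw [hbsq, ← mul_assoc]
  exact le_mul_of_one_le_left (by positivity) hηδ

open Classical in
lemma sampleExpect_indicator_le_of_isUniformProb (hp : IsProbDistribution p)
    (hu : IsUniformProb p) (hT : 0 < T) {δ : ℝ} (h0 : 0 < δ) (h1 : δ < 1) :
    sampleExpect p T (fun x => if (1 + √((J : ℝ) / (T : ℝ)) +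
      (J : ℝ) / √(T : ℝ) * √(8 * Real.log (1 / δ))) * ‖A‖ ^ 2 <
        ‖sampleError A T p x‖ then 1 else 0) ≤ δ := by
  by_cases hA : A = 0
  · subst hA
    simp [sampleError_eq_zero, sampleExpect_const hp, h0.le]
  have hT' : (0 : ℝ) < T := Nat.cast_pos.mpr hT
  have hN : 0 < ‖A‖ ^ 2 := by positivity
  have hJ : 0 < J := by
    rcases Nat.eq_zero_or_pos J with rfl | h
    · simpa using hp.sum_eq_one
    · exact h
  have hJ' : (0 : ℝ) < J := Nat.cast_pos.mpr hJ
  have hpi : ∀ i, (p i)⁻¹ = J := fun i => by rw [hu i, one_div, inv_inv]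
  have hL0 : 0 < Real.log (1 / δ) := Real.log_pos (by rw [lt_div_iff₀ h0]; linarith)
  have hmom : sampleExpect p T (fun x => ‖sampleError A T p x‖ ^ 2) ≤
      J / T * (‖A‖ ^ 2) ^ 2 := by
    refine (sampleExpect_norm_sampleError_sq_le hp hT fun i hi => ?_).trans ?_
    · have := hpi i
      rw [hi, inv_zero] at this
      exact absurd this hJ'.ne
    · rw [div_mul_eq_mul_div]
      refine div_le_div_of_nonneg_right ?_ hT'.le
      simp only [hpi, ← Finset.mul_sum]
      refine mul_le_mul_of_nonneg_left ?_ hJ'.le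
      calc ∑ i, (colNorm A i ^ 2) ^ 2 ≤ ∑ i, ‖A‖ ^ 2 * colNorm A i ^ 2 :=
            Finset.sum_le_sum fun i _ => by
              rw [sq (colNorm A i ^ 2)]
              exact mul_le_mul_of_nonneg_right (colNorm_sq_le A i) (sq_nonneg _)
        _ = _ := by rw [← Finset.mul_sum, sum_colNorm_sq, sq (‖A‖ ^ 2)]
  have hmean : sampleExpect p T (fun x => ‖sampleError A T p x‖) ≤ √(J / T) * ‖A‖ ^ 2 := by
    refine le_of_sq_le_sq ?_ (by positivity)
    rw [mul_pow, Real.sq_sqrt (by positivity)]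
    exact (sampleExpect_sq_le hp _).trans hmom
  have hdiff := abs_norm_sampleError_sub_update_le (A := A) (T := T) (p := p)
    (K := J / T * ‖A‖ ^ 2) fun i => by
      rw [norm_smul, norm_colOuter, mul_inv, hpi, Real.norm_of_nonneg (by positivity),
        inv_mul_eq_div]
      exact mul_le_mul_of_nonneg_left (colNorm_sq_le A i) (by positivity)
  set t := (J : ℝ) / √(T : ℝ) * √(8 * Real.log (1 / δ)) * ‖A‖ ^ 2 with ht
  have ht0 : 0 < t := by positivity
  have hmc := sampleExpect_indicator_le_exp hp (c := 2 * (J / T * ‖A‖ ^ 2)) (t := t)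
    (by positivity) ht0 hT _ hdiff
  -- The 8 under the root in `t` is `2 * 2 ^ 2`: the 2 of the McDiarmid exponent times the squared 2
  -- of the difference bound.
  have hexp : Real.exp (-(t ^ 2 / (2 * T * (2 * (J / T * ‖A‖ ^ 2)) ^ 2))) = δ := by
    have : t ^ 2 / (2 * T * (2 * (J / T * ‖A‖ ^ 2)) ^ 2) = Real.log (1 / δ) := by
      rw [ht, mul_pow, mul_pow, div_pow, Real.sq_sqrt hT'.le, Real.sq_sqrt (by positivity)]
      field_simp
      ring
    rw [this, one_div, Real.log_inv, neg_neg, Real.exp_log h0]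
  rw [hexp] at hmc
  refine le_trans (sampleExpect_mono hp fun x => ?_) hmc
  split_ifs with ha hb hb
  · exact le_rfl
  -- The threshold exceeds the mean bound plus `t` by `‖A‖²`; the summand `1` is pure slack.
  · exact absurd (lt_of_le_of_lt (by nlinarith) ha) hb
  · exact zero_le_one
  · exact le_rfl

end SampledProductBounds

theorem mainTheorem8 {M : ℕ} {I : Fin (M + 1) → ℕ} (A : RealTensor I) (n : Fin (M + 1))
    (T : ℕ) (p : Fin (unfoldCols I n) → ℝ)
    {Ω : Type*} [MeasurableSpace Ω] (μ : Measure Ω) [IsProbabilityMeasure μ]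
    (S : Ω → Matrix (Fin (unfoldCols I n)) (Fin T) ℝ) (hS : IsRandSample T p S μ)
    (C : Ω → Matrix (Fin (I n)) (Fin T) ℝ) (hC : ∀ ω, C ω = modeUnfold A n * S ω) :
    (∀ β : ℝ, IsNearlyOptimal β (modeUnfold A n) (modeUnfold A n)ᵀ p →
      ∀ δ : ℝ, 0 < δ → δ < 1 → ∀ η : ℝ, η = 1 + √((8 / δ) * Real.log (1 / δ)) →
        1 - δ ≤ μ.real {ω | ‖modeUnfold A n * (modeUnfold A n)ᵀ - C ω * (C ω)ᵀ‖ ≤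
          η / √(β * (T : ℝ)) * ‖modeUnfold A n‖ ^ 2}) ∧
    (IsUniformProb p →
      ∀ δ : ℝ, 0 < δ → δ < 1 →
        1 - δ ≤ μ.real {ω | ‖modeUnfold A n * (modeUnfold A n)ᵀ - C ω * (C ω)ᵀ‖ ≤
          (1 + √((unfoldCols I n : ℝ) / (T : ℝ)) +
            (unfoldCols I n : ℝ) / √(T : ℝ) * √(8 * Real.log (1 / δ))) *
              ‖modeUnfold A n‖ ^ 2}) := by
  obtain ⟨hT, hp, ξ, hξ, hind, hSξ⟩ := hS
  have herr : ∀ ω, modeUnfold A n * (modeUnfold A n)ᵀ - C ω * (C ω)ᵀ =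
      sampleError (modeUnfold A n) T p fun j => ξ j ω := fun ω => by
    rw [hC]
    exact sub_mul_transpose_eq_sampleError hp (hSξ ω)
  simp only [herr]
  refine ⟨fun β hβ δ h0 h1 η hη => ?_, fun hu δ h0 h1 => ?_⟩
  · subst hη
    exact one_sub_le_measureReal (f := fun x => ‖sampleError (modeUnfold A n) T p x‖) hp hξ hind
      (sampleExpect_indicator_le_of_isNearlyOptimal hβ hT h0 h1)
  · exact one_sub_le_measureReal (f := fun x => ‖sampleError (modeUnfold A n) T p x‖) hp hξ hind
      (sampleExpect_indicator_le_of_isUniformProb hp hu hT h0 h1)
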